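/- Let $H$ be a separable complex Hilbert space and let $\alpha>-1$. Let $\mathcal{A}^2_\alpha(H)$ be the weighted Bergman space of all analytic functions $f:\mathbb{D}\to H$ on the open unit disc (that is, $f(z)=\sum_{n\ge 0} y_n z^n$ with $y_n\in H$, for all $z\in\mathbb{D}$) such that $$\|f\|^2=\int_{\mathbb{D}}\|f(z)\|^2\,dA_\alpha(z)<\infty,\qquad dA_\alpha(z)=(\alpha+1)(1-|z|^2)^\alpha\,dA(z),$$ where $dA$ is the area measure on $\mathbb{D}$ normalized to total mass $1$; its inner product is given by integrating the pointwise inner product in $H$ against $dA_\alpha$. Let $\Phi:\mathbb{D}\to\mathbb{D}$ be analytic. Then the composition operator $C_\Phi f=f\circ\Phi$ maps $\mathcal{A}^2_\alpha(H)$ into itself, is a bounded linear operator there, and $$\|C_\Phi\|\le\left(\frac{1+|\Phi(0)|}{1-|\Phi(0)|}\right)^{(2+\alpha)/2}.$$ Moreover, if $H\neq\{0\}$ and $\Phi(0)=0$, then $\|C_\Phi\|=1$. -/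

import Mathlib

open MeasureTheory

noncomputable section

namespace VectorBergman

/-- The open unit disc of the complex plane. -/
abbrev Disc : Type := Metric.ball (0 : ℂ) 1

/-- The centre of the disc. -/
def Disc.center : Disc := ⟨0, Metric.mem_ball_self one_pos⟩

/-- Analytic functions on the disc with values in a complex normed space: those that are the sum
of one power series `∑ zⁿ yₙ` on the whole disc. -/
def IsAnalytic {X : Type*} [NormedAddCommGroup X] [NormedSpace ℂ X] (f : Disc → X) : Prop :=
  ∃ y : ℕ → X, ∀ z : Disc, HasSum (fun n : ℕ => (z : ℂ) ^ n • y n) (f z)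

/-- The measure `(α + 1) (1 - |z|²)^α dA(z)` on the disc, where `dA` is Lebesgue measure divided
by `π`. -/
def areaMeasure (α : ℝ) : Measure Disc :=
  (Measure.comap ((↑) : Disc → ℂ) volume).withDensity
    fun z => ENNReal.ofReal ((α + 1) * (1 - ‖(z : ℂ)‖ ^ 2) ^ α * Real.pi⁻¹)

variable {H : Type*} [NormedAddCommGroup H] [InnerProductSpace ℂ H] [CompleteSpace H]

theorem IsAnalytic.continuous {X : Type*} [NormedAddCommGroup X] [NormedSpace ℂ X]
    [CompleteSpace X] {f : Disc → X} (hf : IsAnalytic f) : Continuous f := by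
  obtain ⟨y, hy⟩ := hf
  rw [continuous_iff_continuousAt]
  intro z₀
  obtain ⟨r, hr0, hr1⟩ := exists_between (mem_ball_zero_iff.1 z₀.2)
  obtain ⟨s, hrs, hs1⟩ := exists_between hr1
  have hr : 0 < r := (norm_nonneg _).trans_lt hr0
  have hs : 0 < s := hr.trans hrs
  have hsball : (s : ℂ) ∈ Metric.ball (0 : ℂ) 1 := by
    rw [mem_ball_zero_iff, Complex.norm_real, Real.norm_of_nonneg hs.le]
    exact hs1
  have hlim : Filter.Tendsto (fun n => (s : ℂ) ^ n • y n) Filter.atTop (nhds 0) :=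
    (hy ⟨s, hsball⟩).summable.tendsto_atTop_zero
  obtain ⟨M, hM⟩ := (Metric.isBounded_range_of_tendsto _ hlim).exists_norm_le
  have hbound : ∀ n, s ^ n * ‖y n‖ ≤ M := by
    intro n
    have h := hM _ ⟨n, rfl⟩
    rwa [norm_smul, norm_pow, Complex.norm_real, Real.norm_of_nonneg hs.le] at h
  have hM0 : 0 ≤ M := (by positivity : 0 ≤ s ^ 0 * ‖y 0‖).trans (hbound 0)
  have hsum : Summable fun n => M * (r / s) ^ n :=
    (summable_geometric_of_lt_one (by positivity) ((div_lt_one hs).2 hrs)).mul_left M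
  have hcont : ContinuousOn (fun z : Disc => ∑' n, (z : ℂ) ^ n • y n)
      {z : Disc | ‖(z : ℂ)‖ < r} := by
    refine continuousOn_tsum (fun n => ?_) hsum ?_
    · exact Continuous.continuousOn (by fun_prop)
    · intro n z hz
      have hz' : ‖(z : ℂ)‖ ≤ r := le_of_lt hz
      rw [norm_smul, norm_pow]
      calc ‖(z : ℂ)‖ ^ n * ‖y n‖ ≤ r ^ n * ‖y n‖ := by gcongr
        _ = (s ^ n * ‖y n‖) * (r / s) ^ n := by
          rw [div_pow]; field_simp
        _ ≤ M * (r / s) ^ n := by gcongr; exact hbound n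
  have hopen : IsOpen {z : Disc | ‖(z : ℂ)‖ < r} :=
    isOpen_lt (by fun_prop) continuous_const
  have h := hcont.continuousAt (hopen.mem_nhds hr0)
  have hfun : (fun z : Disc => ∑' n, (z : ℂ) ^ n • y n) = f := funext fun z => (hy z).tsum_eq
  rwa [hfun] at h

theorem IsAnalytic.memLp {f : Disc → H} (hf : IsAnalytic f) {α : ℝ}
    (h : ∫⁻ z, ‖f z‖ₑ ^ 2 ∂(areaMeasure α) < ⊤) : MemLp f 2 (areaMeasure α) := by
  have hm : AEStronglyMeasurable f (areaMeasure α) := hf.continuous.aestronglyMeasurable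
  refine ⟨hm, ?_⟩
  rw [eLpNorm_lt_top_iff_lintegral_rpow_enorm_lt_top two_ne_zero ENNReal.ofNat_ne_top]
  simpa using h

theorem lintegral_lt_top_of_memLp {X : Type*} [NormedAddCommGroup X] {f : Disc → X} {α : ℝ} (h : MemLp f 2 (areaMeasure α)) :
    ∫⁻ z, ‖f z‖ₑ ^ 2 ∂(areaMeasure α) < ⊤ := by
  have h2 := h.2
  rw [eLpNorm_lt_top_iff_lintegral_rpow_enorm_lt_top two_ne_zero ENNReal.ofNat_ne_top] at h2
  simpa using h2

/-- The analytic functions `f` on the disc with `∫ ‖f‖² dA_α < ∞`. -/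
def bergmanSubmodule (α : ℝ) (H : Type*) [NormedAddCommGroup H] [InnerProductSpace ℂ H]
    [CompleteSpace H] : Submodule ℂ (Disc → H) where
  carrier := {f | IsAnalytic f ∧ ∫⁻ z, ‖f z‖ₑ ^ 2 ∂(areaMeasure α) < ⊤}
  zero_mem' := ⟨⟨fun _ => 0, fun z => by simp⟩, by simp⟩
  add_mem' := by
    rintro f g ⟨hf, hf2⟩ ⟨hg, hg2⟩
    refine ⟨?_, lintegral_lt_top_of_memLp ((hf.memLp hf2).add (hg.memLp hg2))⟩
    obtain ⟨y, hy⟩ := hf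
    obtain ⟨s, hs⟩ := hg
    exact ⟨fun n => y n + s n, fun z => by simpa [smul_add] using (hy z).add (hs z)⟩
  smul_mem' := by
    rintro c f ⟨hf, hf2⟩
    refine ⟨?_, lintegral_lt_top_of_memLp ((hf.memLp hf2).const_smul c)⟩
    obtain ⟨y, hy⟩ := hf
    refine ⟨fun n => c • y n, fun z => ?_⟩
    simpa [smul_comm c] using (hy z).const_smul c

/-- The weighted Bergman space of `H`-valued functions on the disc. -/
def BergmanSpace (α : ℝ) (H : Type*) [NormedAddCommGroup H] [InnerProductSpace ℂ H]
    [CompleteSpace H] : Type _ :=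
  bergmanSubmodule α H

namespace BergmanSpace

variable {α : ℝ}

instance : AddCommGroup (BergmanSpace α H) :=
  inferInstanceAs (AddCommGroup (bergmanSubmodule α H))

instance : Module ℂ (BergmanSpace α H) :=
  inferInstanceAs (Module ℂ (bergmanSubmodule α H))

instance : CoeFun (BergmanSpace α H) fun _ => Disc → H := ⟨fun f => f.1⟩

theorem memLp (f : BergmanSpace α H) : MemLp (f : Disc → H) 2 (areaMeasure α) :=
  f.2.1.memLp f.2.2

theorem integrable_inner (f g : BergmanSpace α H) :
    Integrable (fun z => inner ℂ (f z) (g z)) (areaMeasure α) := by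
  refine (L2.integrable_inner (𝕜 := ℂ) (f.memLp.toLp _) (g.memLp.toLp _)).congr ?_
  filter_upwards [f.memLp.coeFn_toLp, g.memLp.coeFn_toLp] with z h1 h2
  rw [h1, h2]

theorem eq_zero_of_integral (hα : -1 < α) (f : BergmanSpace α H)
    (h : ∫ z, inner ℂ (f z) (f z) ∂(areaMeasure α) = 0) : f = 0 := by
  have hcont : Continuous (f : Disc → H) := f.2.1.continuous
  have hint : Integrable (fun z => ‖f z‖ ^ 2) (areaMeasure α) :=
    (memLp_two_iff_integrable_sq_norm f.memLp.1).1 f.memLp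
  have h0 : ∫ z, ‖f z‖ ^ 2 ∂(areaMeasure α) = 0 := by
    have h1 : ∀ z, inner ℂ (f z) (f z) = ((‖f z‖ ^ 2 : ℝ) : ℂ) := fun z => by
      rw [inner_self_eq_norm_sq_to_K]; norm_cast
    simp_rw [h1] at h
    rw [integral_complex_ofReal] at h
    exact_mod_cast h
  rw [integral_eq_zero_iff_of_nonneg (fun z => by positivity) hint] at h0
  have hne : ∀ z : Disc,
      ENNReal.ofReal ((α + 1) * (1 - ‖(z : ℂ)‖ ^ 2) ^ α * Real.pi⁻¹) ≠ 0 := by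
    intro z
    have hz : ‖(z : ℂ)‖ < 1 := mem_ball_zero_iff.1 z.2
    have h1 : 0 < 1 - ‖(z : ℂ)‖ ^ 2 := by nlinarith [norm_nonneg (z : ℂ)]
    have h2 : 0 < α + 1 := by linarith
    have h3 := Real.rpow_pos_of_pos h1 α
    have h4 : 0 < (α + 1) * (1 - ‖(z : ℂ)‖ ^ 2) ^ α * Real.pi⁻¹ := by positivity
    exact (ENNReal.ofReal_pos.2 h4).ne'
  have hmeas : Measurable fun z : Disc =>
      ENNReal.ofReal ((α + 1) * (1 - ‖(z : ℂ)‖ ^ 2) ^ α * Real.pi⁻¹) := by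
    fun_prop
  have hae : ∀ᵐ z ∂(Measure.comap ((↑) : Disc → ℂ) volume), f z = 0 := by
    rw [Filter.EventuallyEq, areaMeasure, ae_withDensity_iff hmeas] at h0
    filter_upwards [h0] with z hz
    simpa using hz (hne z)
  have hall : ∀ z, f z = 0 := by
    intro z
    by_contra hz
    have hopen : IsOpen {w : Disc | f w ≠ 0} := isOpen_ne_fun hcont continuous_const
    have hopen' : IsOpen ((↑) '' {w : Disc | f w ≠ 0} : Set ℂ) :=
      Metric.isOpen_ball.isOpenMap_subtype_val _ hopen
    have hpos := hopen'.measure_pos volume ⟨_, Set.mem_image_of_mem _ hz⟩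
    have hz0 : (Measure.comap ((↑) : Disc → ℂ) volume) {w : Disc | f w ≠ 0} = 0 := hae
    have hcomap := comap_subtype_coe_apply (μ := (volume : Measure ℂ))
      (measurableSet_ball (x := (0 : ℂ)) (ε := 1)) {w : Disc | f w ≠ 0}
    rw [← hcomap] at hpos
    exact hpos.ne' hz0
  exact Subtype.ext (funext hall)

/-- The inner product `∫ ⟪f z, g z⟫ dA_α(z)`. -/
@[reducible]
def core (hα : -1 < α) : InnerProductSpace.Core ℂ (BergmanSpace α H) where
  inner f g := ∫ z, inner ℂ (f z) (g z) ∂(areaMeasure α)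
  conj_inner_symm f g := by
    rw [← integral_conj]
    simp only [inner_conj_symm]
  re_inner_nonneg f := by
    have h1 := integral_re (f.integrable_inner f)
    rw [← h1]
    exact integral_nonneg fun z => inner_self_nonneg
  add_left f g k := by
    rw [← integral_add (f.integrable_inner k) (g.integrable_inner k)]
    exact integral_congr_ae (.of_forall fun z => inner_add_left (f z) (g z) (k z))
  smul_left f g c := by
    rw [← integral_const_mul]
    exact integral_congr_ae (.of_forall fun z => inner_smul_left (f z) (g z) c)
  definite f := eq_zero_of_integral hα f

instance [hα : Fact (-1 < α)] : NormedAddCommGroup (BergmanSpace α H) :=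
  @InnerProductSpace.Core.toNormedAddCommGroup ℂ _ _ _ _ (core hα.out)

instance [hα : Fact (-1 < α)] : InnerProductSpace ℂ (BergmanSpace α H) :=
  InnerProductSpace.ofCore (core hα.out).toCore

theorem norm_sq_eq [Fact (-1 < α)] (f : BergmanSpace α H) :
    ‖f‖ ^ 2 = ∫ z, ‖f z‖ ^ 2 ∂(areaMeasure α) := by
  have h1 : ∀ z, inner ℂ (f z) (f z) = ((‖f z‖ ^ 2 : ℝ) : ℂ) := fun z => by
    rw [inner_self_eq_norm_sq_to_K]; norm_cast
  have h2 : inner ℂ f f = ∫ z, inner ℂ (f z) (f z) ∂(areaMeasure α) := rfl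
  rw [inner_self_eq_norm_sq_to_K] at h2
  simp_rw [h1] at h2
  rw [integral_complex_ofReal] at h2
  have h3 : ((‖f‖ ^ 2 : ℝ) : ℂ) = ((∫ z, ‖f z‖ ^ 2 ∂(areaMeasure α) : ℝ) : ℂ) := by
    rw [← h2]; push_cast; rfl
  exact Complex.ofReal_injective h3

end BergmanSpace

end VectorBergman

end

/-! Write a = Φ(0) and let τ be the involution of the disc exchanging a and 0. Then ψ = τ ∘ Φ fixes
0 and f ∘ Φ = (f ∘ τ) ∘ ψ, so two estimates suffice. Littlewood subordination
(`RotationInvariant.lintegral_comp_le`): composing with ψ does not increase the integral of ‖f‖²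
against a rotation invariant measure. For a polynomial p(w) = y₀ + w q(w), the constant is
orthogonal to the rest, both before and after composing with ψ; Schwarz replaces |ψ|² by |z|², and
induction handles q. Change of variables (`setLIntegral_comp_diskInvolution_le`): with J = |τ'|, the
real Jacobian is J² and 1 - |τ(z)|² = (1 - |z|²) J, so composing with τ costs at most sup J^(2+α),
where J ≤ (1+|a|)/(1-|a|). The square root gives the norm bound. If a = 0 the bound is 1, and it is
attained because constants are fixed. -/

noncomputable section

namespace VectorBergman

open Metric Set Filter Topology

/-! ### Power series on the disc versus complex differentiability -/

section Analytic

variable {X : Type*} [NormedAddCommGroup X] [NormedSpace ℂ X]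

/-- Convergence at a point s with r < s < 1 bounds s ^ n * ‖y n‖; comparison with the geometric
series of ratio r / s follows. -/
theorem summable_pow_mul_norm {y : ℕ → X} (hy : ∀ z : Disc, Summable fun n => (z : ℂ) ^ n • y n)
    {r : ℝ} (hr0 : 0 ≤ r) (hr1 : r < 1) : Summable fun n => r ^ n * ‖y n‖ := by
  obtain ⟨s, hrs, hs1⟩ := exists_between hr1
  have hs : 0 < s := hr0.trans_lt hrs
  have hsball : (s : ℂ) ∈ ball (0 : ℂ) 1 := by
    rwa [mem_ball_zero_iff, Complex.norm_real, Real.norm_of_nonneg hs.le]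
  have hlim := (hy ⟨s, hsball⟩).tendsto_atTop_zero
  obtain ⟨M, hM⟩ := (isBounded_range_of_tendsto _ hlim).exists_norm_le
  have hbound : ∀ n, s ^ n * ‖y n‖ ≤ M := by
    intro n
    have h := hM _ ⟨n, rfl⟩
    rwa [norm_smul, norm_pow, Complex.norm_real, Real.norm_of_nonneg hs.le] at h
  refine Summable.of_nonneg_of_le (fun n => by positivity) (fun n => ?_)
    ((summable_geometric_of_lt_one (by positivity) ((div_lt_one hs).2 hrs)).mul_left M)
  calc r ^ n * ‖y n‖ = (s ^ n * ‖y n‖) * (r / s) ^ n := by rw [div_pow]; field_simp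
    _ ≤ M * (r / s) ^ n := by gcongr; exact hbound n

variable [CompleteSpace X]

theorem IsAnalytic.exists_differentiableOn {f : Disc → X} (hf : IsAnalytic f) :
    ∃ F : ℂ → X, DifferentiableOn ℂ F (ball 0 1) ∧ ∀ z : Disc, F z = f z := by
  obtain ⟨y, hy⟩ := hf
  refine ⟨fun z => ∑' n, z ^ n • y n, fun z hz => ?_, fun z => (hy z).tsum_eq⟩
  obtain ⟨r, hr0, hr1⟩ := exists_between (mem_ball_zero_iff.1 hz)
  have hr : 0 ≤ r := (norm_nonneg _).trans hr0.le
  have h : DifferentiableOn ℂ (fun z : ℂ => ∑' n, z ^ n • y n) (ball 0 r) := by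
    refine Complex.differentiableOn_tsum_of_summable_norm
      (summable_pow_mul_norm (fun z => (hy z).summable) hr hr1) (fun n => ?_) isOpen_ball ?_
    · exact ((differentiable_id.pow n).smul_const (y n)).differentiableOn
    · intro n w hw
      rw [norm_smul, norm_pow]
      have := (mem_ball_zero_iff.1 hw).le
      gcongr
  exact (h.differentiableAt (isOpen_ball.mem_nhds (mem_ball_zero_iff.2 hr0))).differentiableWithinAt

theorem exists_hasSum_of_differentiableOn {F : ℂ → X} (hF : DifferentiableOn ℂ F (ball 0 1)) :
    ∃ y : ℕ → X, ∀ z : Disc, HasSum (fun n => (z : ℂ) ^ n • y n) (F z) := by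
  refine ⟨fun n => (n.factorial : ℂ)⁻¹ • iteratedDeriv n F 0, fun z => ?_⟩
  refine (Complex.hasSum_taylorSeries_on_ball hF z.2).congr_fun fun n => ?_
  rw [sub_zero, smul_comm]

end Analytic

/-! ### Mean value property for rotation invariant measures -/

section Rotation

/-- Invariance of a measure on the plane under all rotations about the origin. -/
def RotationInvariant (μ : Measure ℂ) : Prop :=
  ∀ ω : ℂ, ‖ω‖ = 1 → MeasurePreserving (fun z => ω * z) μ μ

theorem RotationInvariant.restrict_closedBall {μ : Measure ℂ} (hμ : RotationInvariant μ) (r : ℝ) :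
    RotationInvariant (μ.restrict (closedBall 0 r)) := by
  intro ω hω
  have h := (hμ ω hω).restrict_preimage (measurableSet_closedBall (x := (0 : ℂ)) (ε := r))
  have h2 : (fun z => ω * z) ⁻¹' closedBall (0 : ℂ) r = closedBall 0 r := by
    ext z
    simp [hω]
  rwa [h2] at h

/-- Rotating by ω = exp(iπ/n), for which ω ^ n = -1, shows that the integral equals its own
negative. -/
theorem RotationInvariant.integral_norm_pow_smul_pow_eq_zero {X : Type*} [NormedAddCommGroup X]
    [NormedSpace ℂ X] {μ : Measure ℂ} (hμ : RotationInvariant μ) (k : ℕ) {n : ℕ} (hn : n ≠ 0)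
    (c : X) : ∫ z, ((‖z‖ ^ k : ℝ) : ℂ) • z ^ n • c ∂μ = 0 := by
  set ω : ℂ := Complex.exp ((Real.pi / n : ℝ) * Complex.I) with hω
  have hω1 : ‖ω‖ = 1 := Complex.norm_exp_ofReal_mul_I _
  have hω0 : ω ≠ 0 := Complex.exp_ne_zero _
  have hωn : ω ^ n = -1 := by
    rw [hω, ← Complex.exp_nat_mul, ← Complex.exp_pi_mul_I]
    congr 1
    have : (n : ℂ) ≠ 0 := Nat.cast_ne_zero.2 hn
    push_cast
    field_simp
  have h := (hμ ω hω1).integral_comp (Homeomorph.mulLeft₀ ω hω0).measurableEmbedding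
    (fun z => ((‖z‖ ^ k : ℝ) : ℂ) • z ^ n • c)
  simp only [norm_mul, hω1, one_mul, mul_pow, hωn, neg_smul, neg_mul, smul_neg,
    integral_neg] at h
  have h2 : (2 : ℂ) • ∫ z, ((‖z‖ ^ k : ℝ) : ℂ) • z ^ n • c ∂μ = 0 := by
    rw [two_smul]
    nth_rewrite 1 [← h]
    exact neg_add_cancel _
  exact (smul_eq_zero.1 h2).resolve_left two_ne_zero

variable {μ : Measure ℂ} [IsFiniteMeasure μ] {r : ℝ}

theorem integrableOn_closedBall {X : Type*} [NormedAddCommGroup X] (hr : r < 1) {f : ℂ → X}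
    (hf : ContinuousOn f (ball 0 1)) : IntegrableOn f (closedBall 0 r) μ :=
  (hf.mono (closedBall_subset_ball hr)).integrableOn_compact (isCompact_closedBall 0 r)

/-- The Taylor series of `h` has no constant term and every other term integrates to zero. Staying
on a closed ball of radius r < 1 makes the termwise integration legitimate. -/
theorem RotationInvariant.setIntegral_eq_zero {X : Type*} [NormedAddCommGroup X] [NormedSpace ℂ X]
    [CompleteSpace X] (hμ : RotationInvariant μ) (hr0 : 0 ≤ r) (hr : r < 1) (k : ℕ) {h : ℂ → X}
    (hd : DifferentiableOn ℂ h (ball 0 1)) (h0 : h 0 = 0) :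
    ∫ z in closedBall 0 r, ((‖z‖ ^ k : ℝ) : ℂ) • h z ∂μ = 0 := by
  obtain ⟨y, hy⟩ := exists_hasSum_of_differentiableOn hd
  have hs := summable_pow_mul_norm (fun z => (hy z).summable) hr0 hr
  have hy0 : y 0 = 0 := by
    have h1 := hy Disc.center
    have h2 : HasSum (fun n => (Disc.center : ℂ) ^ n • y n) ((0 : ℂ) ^ 0 • y 0) :=
      hasSum_single 0 fun n hn => by simp [Disc.center, hn]
    have h3 := h1.unique h2
    simpa [Disc.center, h0] using h3.symm
  have hterm : ∀ n, ∫ z in closedBall 0 r, ((‖z‖ ^ k : ℝ) : ℂ) • z ^ n • y n ∂μ = 0 := by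
    intro n
    rcases eq_or_ne n 0 with rfl | hn
    · simp [hy0]
    · exact (hμ.restrict_closedBall r).integral_norm_pow_smul_pow_eq_zero k hn _
  have hint : ∀ n, IntegrableOn (fun z : ℂ => ((‖z‖ ^ k : ℝ) : ℂ) • z ^ n • y n)
      (closedBall 0 r) μ := fun n =>
    integrableOn_closedBall hr (Continuous.continuousOn (by fun_prop))
  have hsum : Summable fun n => ∫ z in closedBall 0 r, ‖((‖z‖ ^ k : ℝ) : ℂ) • z ^ n • y n‖ ∂μ := by
    refine Summable.of_nonneg_of_le (fun n => integral_nonneg fun z => norm_nonneg _) (fun n => ?_)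
      (hs.mul_right (μ.real (closedBall 0 r)))
    have h1 : ∀ z ∈ closedBall (0 : ℂ) r, ‖((‖z‖ ^ k : ℝ) : ℂ) • z ^ n • y n‖ ≤ r ^ n * ‖y n‖ := by
      intro z hz
      have hz' : ‖z‖ ≤ r := mem_closedBall_zero_iff.1 hz
      rw [norm_smul, norm_smul, norm_pow, Complex.norm_real, norm_pow, norm_norm]
      calc ‖z‖ ^ k * (‖z‖ ^ n * ‖y n‖) ≤ 1 * (r ^ n * ‖y n‖) := by
            gcongr
            exact pow_le_one₀ (norm_nonneg z) (hz'.trans hr.le)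
        _ = r ^ n * ‖y n‖ := one_mul _
    calc ∫ z in closedBall 0 r, ‖((‖z‖ ^ k : ℝ) : ℂ) • z ^ n • y n‖ ∂μ
        ≤ ∫ z in closedBall (0 : ℂ) r, r ^ n * ‖y n‖ ∂μ :=
          setIntegral_mono_on (hint n).norm (integrable_const _) measurableSet_closedBall h1
      _ = r ^ n * ‖y n‖ * μ.real (closedBall 0 r) := by
          rw [setIntegral_const, smul_eq_mul, mul_comm]
  have key := hasSum_integral_of_summable_integral_norm hint hsum
  simp only [hterm] at key
  have h1 := key.unique hasSum_zero
  rw [← h1]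
  refine setIntegral_congr_fun measurableSet_closedBall fun z hz => ?_
  exact (((hy ⟨z, closedBall_subset_ball hr hz⟩).const_smul _).tsum_eq).symm

end Rotation

/-! ### Littlewood subordination -/

section Subordination

variable {H : Type*} [NormedAddCommGroup H] [InnerProductSpace ℂ H] [CompleteSpace H]
  {μ : Measure ℂ} [IsFiniteMeasure μ] {r : ℝ}

/-- Pythagoras: the cross term is twice the real part of the inner product of `c` with the weighted
integral of `h`, which vanishes. -/
theorem RotationInvariant.setIntegral_norm_const_add_sq (hμ : RotationInvariant μ) (hr0 : 0 ≤ r)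
    (hr : r < 1) (k : ℕ) (c : H) {h : ℂ → H} (hd : DifferentiableOn ℂ h (ball 0 1))
    (h0 : h 0 = 0) :
    ∫ z in closedBall 0 r, ‖z‖ ^ k * ‖c + h z‖ ^ 2 ∂μ =
      ∫ z in closedBall 0 r, ‖z‖ ^ k * ‖c‖ ^ 2 ∂μ +
        ∫ z in closedBall 0 r, ‖z‖ ^ k * ‖h z‖ ^ 2 ∂μ := by
  have hc := hd.continuousOn
  have hi : IntegrableOn (fun z => ((‖z‖ ^ k : ℝ) : ℂ) • h z) (closedBall 0 r) μ :=
    integrableOn_closedBall hr (by fun_prop)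
  have h1 : ∫ z in closedBall 0 r, RCLike.re (inner ℂ c (((‖z‖ ^ k : ℝ) : ℂ) • h z)) ∂μ = 0 := by
    rw [integral_re (hi.const_inner c), integral_inner hi,
      hμ.setIntegral_eq_zero hr0 hr k hd h0]
    simp
  have h2 : ∀ z, ‖z‖ ^ k * ‖c + h z‖ ^ 2 = ‖z‖ ^ k * ‖c‖ ^ 2 + ‖z‖ ^ k * ‖h z‖ ^ 2 +
      2 * RCLike.re (inner ℂ c (((‖z‖ ^ k : ℝ) : ℂ) • h z)) := by
    intro z
    rw [norm_add_sq (𝕜 := ℂ), inner_smul_right]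
    have : RCLike.re ((((‖z‖ ^ k : ℝ) : ℂ)) * inner ℂ c (h z)) =
        ‖z‖ ^ k * RCLike.re (inner ℂ c (h z)) := Complex.re_ofReal_mul _ _
    rw [this]
    ring
  have i1 : IntegrableOn (fun z : ℂ => ‖z‖ ^ k * ‖c‖ ^ 2) (closedBall 0 r) μ :=
    integrableOn_closedBall hr (Continuous.continuousOn (by fun_prop))
  have i2 : IntegrableOn (fun z => ‖z‖ ^ k * ‖h z‖ ^ 2) (closedBall 0 r) μ :=
    integrableOn_closedBall hr (by fun_prop)
  have i3 : IntegrableOn (fun z => RCLike.re (inner ℂ c (((‖z‖ ^ k : ℝ) : ℂ) • h z)))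
      (closedBall 0 r) μ := (hi.const_inner c).re
  simp_rw [h2]
  have e := integral_add (i1.add i2) (i3.const_mul 2)
  simp only [Pi.add_apply] at e
  rw [e, integral_add i1 i2, integral_const_mul, h1, mul_zero, add_zero]

/-- Littlewood subordination for polynomials. -/
theorem RotationInvariant.setIntegral_polynomial_comp_le (hμ : RotationInvariant μ) (hr0 : 0 ≤ r)
    (hr : r < 1) {ψ : ℂ → ℂ} (hψ : DifferentiableOn ℂ ψ (ball 0 1))
    (hmaps : MapsTo ψ (ball 0 1) (ball 0 1)) (hψ0 : ψ 0 = 0) (N : ℕ) :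
    ∀ (k : ℕ) (y : ℕ → H),
      ∫ z in closedBall 0 r, ‖z‖ ^ k * ‖∑ n ∈ Finset.range N, ψ z ^ n • y n‖ ^ 2 ∂μ ≤
        ∫ z in closedBall 0 r, ‖z‖ ^ k * ‖∑ n ∈ Finset.range N, z ^ n • y n‖ ^ 2 ∂μ := by
  -- The exponent `k` must stay general: peeling off one factor ψ(z) and applying Schwarz raises it
  -- by 2.
  induction N with
  | zero => simp
  | succ N ih =>
    intro k y
    have split : ∀ w : ℂ, ∑ n ∈ Finset.range (N + 1), w ^ n • y n =
        y 0 + w • ∑ n ∈ Finset.range N, w ^ n • y (n + 1) := by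
      intro w
      rw [Finset.sum_range_succ', add_comm, Finset.smul_sum]
      simp [pow_succ', mul_smul]
    have dp : Differentiable ℂ fun w : ℂ => w • ∑ n ∈ Finset.range N, w ^ n • y (n + 1) := by
      fun_prop
    have dpψ : DifferentiableOn ℂ (fun z => ψ z • ∑ n ∈ Finset.range N, ψ z ^ n • y (n + 1))
        (ball 0 1) := dp.comp_differentiableOn hψ
    have hψc := hψ.continuousOn
    simp_rw [split]
    rw [hμ.setIntegral_norm_const_add_sq hr0 hr k (y 0) dpψ (by simp [hψ0]),
      hμ.setIntegral_norm_const_add_sq hr0 hr k (y 0) dp.differentiableOn (by simp)]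
    refine add_le_add_right ?_ _
    calc ∫ z in closedBall 0 r,
          ‖z‖ ^ k * ‖ψ z • ∑ n ∈ Finset.range N, ψ z ^ n • y (n + 1)‖ ^ 2 ∂μ
        ≤ ∫ z in closedBall 0 r,
          ‖z‖ ^ (k + 2) * ‖∑ n ∈ Finset.range N, ψ z ^ n • y (n + 1)‖ ^ 2 ∂μ := by
          refine setIntegral_mono_on (integrableOn_closedBall hr (by fun_prop))
            (integrableOn_closedBall hr (by fun_prop)) measurableSet_closedBall fun z hz => ?_
          have hz1 : ‖z‖ < 1 := (mem_closedBall_zero_iff.1 hz).trans_lt hr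
          have hsch : ‖ψ z‖ ≤ ‖z‖ := Complex.norm_le_norm_of_mapsTo_ball hψ
            (hmaps.mono_right ball_subset_closedBall) hψ0 hz1
          rw [norm_smul, mul_pow, pow_add, mul_assoc]
          gcongr
      _ ≤ ∫ z in closedBall 0 r,
          ‖z‖ ^ (k + 2) * ‖∑ n ∈ Finset.range N, z ^ n • y (n + 1)‖ ^ 2 ∂μ :=
          ih (k + 2) fun n => y (n + 1)
      _ = ∫ z in closedBall 0 r,
          ‖z‖ ^ k * ‖z • ∑ n ∈ Finset.range N, z ^ n • y (n + 1)‖ ^ 2 ∂μ := by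
          congr 1 with z
          rw [norm_smul, mul_pow, pow_add, mul_assoc]

theorem RotationInvariant.setIntegral_comp_le (hμ : RotationInvariant μ) (hr0 : 0 ≤ r)
    (hr : r < 1) {ψ : ℂ → ℂ} (hψ : DifferentiableOn ℂ ψ (ball 0 1))
    (hmaps : MapsTo ψ (ball 0 1) (ball 0 1)) (hψ0 : ψ 0 = 0) {f : ℂ → H}
    (hf : DifferentiableOn ℂ f (ball 0 1)) :
    ∫ z in closedBall 0 r, ‖f (ψ z)‖ ^ 2 ∂μ ≤ ∫ z in closedBall 0 r, ‖f z‖ ^ 2 ∂μ := by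
  obtain ⟨y, hy⟩ := exists_hasSum_of_differentiableOn hf
  have hs := summable_pow_mul_norm (fun z => (hy z).summable) hr0 hr
  -- Used for χ = ψ, which preserves the closed ball by Schwarz, and for χ = id. The partial sums
  -- share one constant bound, so dominated convergence applies.
  have lim : ∀ χ : ℂ → ℂ, ContinuousOn χ (ball 0 1) → (∀ z ∈ closedBall (0 : ℂ) r, ‖χ z‖ ≤ r) →
      Tendsto (fun N => ∫ z in closedBall 0 r, ‖∑ n ∈ Finset.range N, χ z ^ n • y n‖ ^ 2 ∂μ)
        atTop (𝓝 (∫ z in closedBall 0 r, ‖f (χ z)‖ ^ 2 ∂μ)) := by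
    intro χ hχ hχr
    refine tendsto_integral_of_dominated_convergence (fun _ => (∑' n, r ^ n * ‖y n‖) ^ 2)
      (fun N => ?_) (integrable_const _) (fun N => ?_) ?_
    · exact (integrableOn_closedBall hr (by fun_prop)).aestronglyMeasurable
    · refine (ae_restrict_mem measurableSet_closedBall).mono fun z hz => ?_
      rw [norm_pow, norm_norm]
      gcongr
      calc ‖∑ n ∈ Finset.range N, χ z ^ n • y n‖
          ≤ ∑ n ∈ Finset.range N, r ^ n * ‖y n‖ := by
            refine norm_sum_le_of_le _ fun n _ => ?_
            rw [norm_smul, norm_pow]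
            have := hχr z hz
            gcongr
        _ ≤ ∑' n, r ^ n * ‖y n‖ := hs.sum_le_tsum _ fun n _ => by positivity
    · refine (ae_restrict_mem measurableSet_closedBall).mono fun z hz => ?_
      have hz1 : χ z ∈ ball (0 : ℂ) 1 := mem_ball_zero_iff.2 ((hχr z hz).trans_lt hr)
      exact ((hy ⟨χ z, hz1⟩).tendsto_sum_nat.norm).pow 2
  refine le_of_tendsto_of_tendsto' (lim ψ hψ.continuousOn fun z hz => ?_)
    (lim id continuousOn_id fun z hz => mem_closedBall_zero_iff.1 hz) fun N => ?_
  · have hz' : ‖z‖ ≤ r := mem_closedBall_zero_iff.1 hz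
    exact (Complex.norm_le_norm_of_mapsTo_ball hψ
      (hmaps.mono_right ball_subset_closedBall) hψ0 (hz'.trans_lt hr)).trans hz'
  · simpa using hμ.setIntegral_polynomial_comp_le hr0 hr hψ hmaps hψ0 N 0 y

/-- Littlewood subordination for rotation invariant measures on the disc. -/
theorem RotationInvariant.lintegral_comp_le (hμ : RotationInvariant μ) {ψ : ℂ → ℂ}
    (hψ : DifferentiableOn ℂ ψ (ball 0 1)) (hmaps : MapsTo ψ (ball 0 1) (ball 0 1))
    (hψ0 : ψ 0 = 0) {f : ℂ → H} (hf : DifferentiableOn ℂ f (ball 0 1)) :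
    ∫⁻ z in ball 0 1, ‖f (ψ z)‖ₑ ^ 2 ∂μ ≤ ∫⁻ z in ball 0 1, ‖f z‖ₑ ^ 2 ∂μ := by
  obtain ⟨u, hu, hu1, hulim⟩ := exists_seq_strictMono_tendsto' (zero_lt_one (α := ℝ))
  have hU : ball (0 : ℂ) 1 = ⋃ n, closedBall 0 (u n) := by
    refine Subset.antisymm (fun z hz => ?_)
      (iUnion_subset fun n => closedBall_subset_ball (hu1 n).2)
    obtain ⟨n, hn⟩ := (hulim.eventually (lt_mem_nhds (mem_ball_zero_iff.1 hz))).exists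
    exact mem_iUnion.2 ⟨n, mem_closedBall_zero_iff.2 hn.le⟩
  have hdir : Directed (· ⊆ ·) fun n => closedBall (0 : ℂ) (u n) :=
    Monotone.directed_le fun m n hmn => closedBall_subset_closedBall (hu.monotone hmn)
  have conv : ∀ (g : ℂ → H) (n : ℕ), ContinuousOn g (ball 0 1) →
      ∫⁻ z in closedBall 0 (u n), ‖g z‖ₑ ^ 2 ∂μ =
        ENNReal.ofReal (∫ z in closedBall 0 (u n), ‖g z‖ ^ 2 ∂μ) := by
    intro g n hg
    rw [ofReal_integral_eq_lintegral_ofReal (integrableOn_closedBall (hu1 n).2 (by fun_prop))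
      (Eventually.of_forall fun z => by positivity)]
    congr 1 with z
    rw [ENNReal.ofReal_pow (norm_nonneg _), ofReal_norm]
  -- Only the left side is written as a supremum over closed balls; on the right, enlarging the
  -- domain is enough.
  nth_rewrite 1 [hU]
  rw [setLIntegral_iUnion_of_directed _ hdir]
  refine iSup_le fun n => le_trans ?_ (lintegral_mono_set (closedBall_subset_ball (hu1 n).2))
  rw [conv (fun z => f (ψ z)) n (hf.comp hψ hmaps).continuousOn, conv _ n hf.continuousOn]
  exact ENNReal.ofReal_le_ofReal
    (hμ.setIntegral_comp_le (hu1 n).1.le (hu1 n).2 hψ hmaps hψ0 hf)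

end Subordination

/-! ### The weighted area measure on the plane -/

section PlaneMeasure

/-- The density of `areaMeasure` with respect to Lebesgue measure. -/
def areaDensity (α : ℝ) (z : ℂ) : ENNReal :=
  ENNReal.ofReal ((α + 1) * (1 - ‖z‖ ^ 2) ^ α * Real.pi⁻¹)

theorem measurable_areaDensity (α : ℝ) : Measurable (areaDensity α) := by
  unfold areaDensity
  fun_prop

/-- `areaMeasure`, as a measure on the plane that is concentrated on the disc. -/
def planeMeasure (α : ℝ) : Measure ℂ :=
  (volume.restrict (ball 0 1)).withDensity (areaDensity α)

/-- The right side also appears in `lintegral_areaMeasure`; it is the common form through which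
estimates pass between plane and disc. Finiteness of the density lets `g` be arbitrary. -/
theorem setLIntegral_planeMeasure (α : ℝ) (g : ℂ → ENNReal) :
    ∫⁻ z in ball 0 1, g z ∂(planeMeasure α) = ∫⁻ z in ball 0 1, areaDensity α z * g z := by
  rw [planeMeasure, restrict_withDensity measurableSet_ball, Measure.restrict_restrict_of_subset
    Subset.rfl, lintegral_withDensity_eq_lintegral_mul_non_measurable _ (measurable_areaDensity α)
    (Eventually.of_forall fun z => ENNReal.ofReal_lt_top)]
  rfl

theorem lintegral_areaMeasure (α : ℝ) (g : ℂ → ENNReal) :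
    ∫⁻ z : Disc, g z ∂(areaMeasure α) = ∫⁻ z in ball 0 1, areaDensity α z * g z := by
  have hm : Measurable fun z : Disc =>
      ENNReal.ofReal ((α + 1) * (1 - ‖(z : ℂ)‖ ^ 2) ^ α * Real.pi⁻¹) := by
    fun_prop
  rw [areaMeasure, lintegral_withDensity_eq_lintegral_mul_non_measurable _ hm
    (Eventually.of_forall fun z => ENNReal.ofReal_lt_top)]
  exact lintegral_subtype_comap measurableSet_ball fun z => areaDensity α z * g z

theorem rotationInvariant_planeMeasure (α : ℝ) : RotationInvariant (planeMeasure α) := by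
  intro ω hω
  have hm : Measurable fun z : ℂ => ω * z := by fun_prop
  refine ⟨hm, Measure.ext fun s hs => ?_⟩
  have hvol : MeasurePreserving (fun z : ℂ => ω * z) volume volume :=
    (rotation ⟨ω, mem_sphere_zero_iff_norm.2 hω⟩).measurePreserving
  have hdens : Measurable ((ball (0 : ℂ) 1).indicator (areaDensity α)) :=
    (measurable_areaDensity α).indicator measurableSet_ball
  have hrot : ∀ z, (ball (0 : ℂ) 1).indicator (areaDensity α) (ω * z) =
      (ball (0 : ℂ) 1).indicator (areaDensity α) z := fun z => by
    simp [indicator, areaDensity, hω]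
  rw [Measure.map_apply hm hs, planeMeasure, ← withDensity_indicator measurableSet_ball,
    withDensity_apply _ (hm hs), withDensity_apply _ hs,
    ← hvol.setLIntegral_comp_preimage hs hdens]
  simp_rw [hrot]

/-- In polar coordinates the integrand is y (1 + y)^α (1 - y)^α: a continuous factor on [0, 1] times
(1 - y)^α, integrable because α > -1. -/
theorem integrableOn_one_sub_norm_sq_rpow {α : ℝ} (hα : -1 < α) :
    IntegrableOn (fun z : ℂ => (1 - ‖z‖ ^ 2) ^ α) (ball 0 1) := by
  rw [integrableOn_fun_norm_addHaar volume (f := fun y : ℝ => (1 - y ^ 2) ^ α),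
    Complex.finrank_real_complex]
  have h1 : IntervalIntegrable (fun y : ℝ => (1 - y) ^ α) volume 0 1 := by
    have := (intervalIntegral.intervalIntegrable_rpow' (a := 1) (b := 0) hα).comp_sub_left 1
    simpa using this
  rw [intervalIntegrable_iff_integrableOn_Icc_of_le zero_le_one] at h1
  have h2 : ContinuousOn (fun y : ℝ => y * (1 + y) ^ α) (Icc 0 1) := by
    refine continuousOn_id.mul ((continuousOn_const.add continuousOn_id).rpow_const fun y hy => ?_)
    exact Or.inl (add_pos_of_pos_of_nonneg one_pos hy.1).ne'
  refine ((h1.continuousOn_mul h2 isCompact_Icc).mono_set Ioo_subset_Icc_self).congr_fun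
    (fun y hy => ?_) measurableSet_Ioo
  have hy0 := hy.1
  have hy1 := hy.2
  have : 1 - y ^ 2 = (1 + y) * (1 - y) := by ring
  simp only [this, smul_eq_mul]
  rw [Real.mul_rpow (by linarith) (by linarith)]
  simp [mul_assoc]

theorem setLIntegral_areaDensity_lt_top {α : ℝ} (hα : -1 < α) :
    ∫⁻ z in ball 0 1, areaDensity α z < ⊤ := by
  have h := ((integrableOn_one_sub_norm_sq_rpow hα).const_mul (α + 1)).mul_const Real.pi⁻¹
  exact h.lintegral_lt_top

instance (α : ℝ) [hα : Fact (-1 < α)] : IsFiniteMeasure (planeMeasure α) :=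
  isFiniteMeasure_withDensity (setLIntegral_areaDensity_lt_top hα.out).ne

instance (α : ℝ) [hα : Fact (-1 < α)] : IsFiniteMeasure (areaMeasure α) := by
  refine ⟨?_⟩
  rw [← lintegral_one]
  have h := lintegral_areaMeasure α fun _ => 1
  simp only [mul_one] at h
  rw [h]
  exact setLIntegral_areaDensity_lt_top hα.out

end PlaneMeasure

/-! ### Disc involutions and their Jacobians -/

section Moebius

open ComplexConjugate

/-- The involutive automorphism of the disc that exchanges `a` and `0`. -/
def diskInvolution (a z : ℂ) : ℂ := (a - z) / (1 - conj a * z)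

variable {a z : ℂ}

theorem one_sub_norm_le_norm_one_sub_conj_mul (hz : ‖z‖ < 1) :
    1 - ‖a‖ ≤ ‖1 - conj a * z‖ := by
  have h := norm_sub_norm_le 1 (conj a * z)
  rw [norm_one, norm_mul, RCLike.norm_conj] at h
  nlinarith [norm_nonneg a, norm_nonneg z]

theorem one_sub_conj_mul_ne_zero (ha : ‖a‖ < 1) (hz : ‖z‖ < 1) : 1 - conj a * z ≠ 0 :=
  norm_pos_iff.1 ((sub_pos.2 ha).trans_le (one_sub_norm_le_norm_one_sub_conj_mul hz))

/-- The second factor on the right is the modulus of the derivative (`norm_deriv_diskInvolution`),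
so the weight and the Jacobian combine into a single power. -/
theorem one_sub_norm_diskInvolution_sq (ha : ‖a‖ < 1) (hz : ‖z‖ < 1) :
    1 - ‖diskInvolution a z‖ ^ 2 =
      (1 - ‖z‖ ^ 2) * ((1 - ‖a‖ ^ 2) / ‖1 - conj a * z‖ ^ 2) := by
  have h := norm_pos_iff.2 (one_sub_conj_mul_ne_zero ha hz)
  rw [diskInvolution, norm_div, div_pow]
  have key : ‖1 - conj a * z‖ ^ 2 - ‖a - z‖ ^ 2 = (1 - ‖z‖ ^ 2) * (1 - ‖a‖ ^ 2) := by
    simp only [← Complex.normSq_eq_norm_sq, Complex.normSq_apply, Complex.sub_re, Complex.sub_im,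
      Complex.mul_re, Complex.mul_im, Complex.conj_re, Complex.conj_im, Complex.one_re,
      Complex.one_im]
    ring
  rw [← mul_div_assoc, ← key, sub_div, div_self (by positivity)]

theorem norm_diskInvolution_lt_one (ha : ‖a‖ < 1) (hz : ‖z‖ < 1) : ‖diskInvolution a z‖ < 1 := by
  have h := one_sub_norm_diskInvolution_sq ha hz
  have h0 := norm_pos_iff.2 (one_sub_conj_mul_ne_zero ha hz)
  have h1 : 0 < 1 - ‖z‖ ^ 2 := by nlinarith [norm_nonneg z]
  have h2 : 0 < 1 - ‖a‖ ^ 2 := by nlinarith [norm_nonneg a]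
  have h3 : 0 < 1 - ‖diskInvolution a z‖ ^ 2 := by rw [h]; positivity
  nlinarith [norm_nonneg (diskInvolution a z)]

theorem mapsTo_diskInvolution (ha : ‖a‖ < 1) :
    MapsTo (diskInvolution a) (ball 0 1) (ball 0 1) := fun _ hz =>
  mem_ball_zero_iff.2 (norm_diskInvolution_lt_one ha (mem_ball_zero_iff.1 hz))

theorem diskInvolution_diskInvolution (ha : ‖a‖ < 1) (hz : ‖z‖ < 1) :
    diskInvolution a (diskInvolution a z) = z := by
  have h1 := one_sub_conj_mul_ne_zero ha hz
  have h2 := one_sub_conj_mul_ne_zero ha (norm_diskInvolution_lt_one ha hz)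
  have h3 := one_sub_conj_mul_ne_zero ha ha
  have e1 : a - diskInvolution a z = z * (1 - conj a * a) / (1 - conj a * z) := by
    rw [diskInvolution, eq_div_iff h1, sub_mul, div_mul_cancel₀ _ h1]
    ring
  have e2 : 1 - conj a * diskInvolution a z = (1 - conj a * a) / (1 - conj a * z) := by
    rw [diskInvolution, eq_div_iff h1, sub_mul, mul_assoc, div_mul_cancel₀ _ h1]
    ring
  rw [diskInvolution, e1, e2, div_div_div_cancel_right₀ h1, mul_div_cancel_right₀ _ h3]

theorem hasDerivAt_diskInvolution (ha : ‖a‖ < 1) (hz : ‖z‖ < 1) :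
    HasDerivAt (diskInvolution a) (-(1 - conj a * a) / (1 - conj a * z) ^ 2) z := by
  have h1 : HasDerivAt (fun w => a - w) (-1) z := (hasDerivAt_id z).const_sub a
  have h2 : HasDerivAt (fun w => 1 - conj a * w) (-(conj a * 1)) z :=
    ((hasDerivAt_id z).const_mul (conj a)).const_sub 1
  refine (h1.div h2 (one_sub_conj_mul_ne_zero ha hz)).congr_deriv ?_
  congr 1
  ring

theorem differentiableOn_diskInvolution (ha : ‖a‖ < 1) :
    DifferentiableOn ℂ (diskInvolution a) (ball 0 1) := fun _ hz =>
  (hasDerivAt_diskInvolution ha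
    (mem_ball_zero_iff.1 hz)).differentiableAt.differentiableWithinAt

theorem norm_deriv_diskInvolution (ha : ‖a‖ < 1) :
    ‖-(1 - conj a * a) / (1 - conj a * z) ^ 2‖ = (1 - ‖a‖ ^ 2) / ‖1 - conj a * z‖ ^ 2 := by
  have h1 : conj a * a = ((‖a‖ ^ 2 : ℝ) : ℂ) := by rw [RCLike.conj_mul]; norm_cast
  have h2 : 0 ≤ 1 - ‖a‖ ^ 2 := by nlinarith [norm_nonneg a]
  rw [norm_div, norm_neg, norm_pow, h1, ← Complex.ofReal_one, ← Complex.ofReal_sub,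
    Complex.norm_real, Real.norm_of_nonneg h2]

theorem norm_deriv_diskInvolution_le (ha : ‖a‖ < 1) (hz : ‖z‖ < 1) :
    (1 - ‖a‖ ^ 2) / ‖1 - conj a * z‖ ^ 2 ≤ (1 + ‖a‖) / (1 - ‖a‖) := by
  have h0 : 0 < 1 - ‖a‖ := sub_pos.2 ha
  have h1 := one_sub_norm_le_norm_one_sub_conj_mul (a := a) hz
  have h2 : 0 ≤ 1 - ‖a‖ ^ 2 := by nlinarith [norm_nonneg a]
  calc (1 - ‖a‖ ^ 2) / ‖1 - conj a * z‖ ^ 2 ≤ (1 - ‖a‖ ^ 2) / (1 - ‖a‖) ^ 2 := by gcongr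
    _ = (1 + ‖a‖) / (1 - ‖a‖) := by field_simp; ring

theorem det_restrictScalars_toSpanSingleton (c : ℂ) :
    ((ContinuousLinearMap.toSpanSingleton ℂ c).restrictScalars ℝ).det = ‖c‖ ^ 2 := by
  simp [ContinuousLinearMap.det, LinearMap.det_restrictScalars,
    Algebra.norm_complex_eq, Complex.normSq_eq_norm_sq]

/-- The Jacobian J² and the factor J^α from the density are merged before J is bounded: α may be
negative, but 2 + α is positive. -/
theorem ofReal_jacobian_mul_areaDensity_le {α : ℝ} (hα : -1 < α) (ha : ‖a‖ < 1) (hz : ‖z‖ < 1) :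
    ENNReal.ofReal (((1 - ‖a‖ ^ 2) / ‖1 - conj a * z‖ ^ 2) ^ 2) *
        areaDensity α (diskInvolution a z) ≤
      ENNReal.ofReal (((1 + ‖a‖) / (1 - ‖a‖)) ^ (2 + α)) * areaDensity α z := by
  have h0 := norm_pos_iff.2 (one_sub_conj_mul_ne_zero ha hz)
  have h1 : 0 < 1 - ‖z‖ ^ 2 := by nlinarith [norm_nonneg z]
  have h2 : 0 < 1 - ‖a‖ ^ 2 := by nlinarith [norm_nonneg a]
  have hle := norm_deriv_diskInvolution_le ha hz
  rw [areaDensity, areaDensity, one_sub_norm_diskInvolution_sq ha hz]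
  set J := (1 - ‖a‖ ^ 2) / ‖1 - conj a * z‖ ^ 2 with hJ
  set K := (1 + ‖a‖) / (1 - ‖a‖)
  have hJ0 : 0 < J := by positivity
  have hα1 : 0 < α + 1 := by linarith
  rw [← ENNReal.ofReal_mul (by positivity),
    ← ENNReal.ofReal_mul (Real.rpow_nonneg (hJ0.le.trans hle) _)]
  refine ENNReal.ofReal_le_ofReal ?_
  rw [Real.mul_rpow h1.le hJ0.le]
  have hpow : J ^ 2 * J ^ α ≤ K ^ (2 + α) := by
    rw [← Real.rpow_natCast, ← Real.rpow_add hJ0]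
    push_cast
    exact Real.rpow_le_rpow hJ0.le hle (by linarith)
  calc J ^ 2 * ((α + 1) * ((1 - ‖z‖ ^ 2) ^ α * J ^ α) * Real.pi⁻¹)
      = (J ^ 2 * J ^ α) * ((α + 1) * (1 - ‖z‖ ^ 2) ^ α * Real.pi⁻¹) := by ring
    _ ≤ K ^ (2 + α) * ((α + 1) * (1 - ‖z‖ ^ 2) ^ α * Real.pi⁻¹) := by gcongr

theorem setLIntegral_comp_diskInvolution_le {α : ℝ} (hα : -1 < α) (ha : ‖a‖ < 1)
    (g : ℂ → ENNReal) :
    ∫⁻ z in ball 0 1, areaDensity α z * g (diskInvolution a z) ≤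
      ENNReal.ofReal (((1 + ‖a‖) / (1 - ‖a‖)) ^ (2 + α)) *
        ∫⁻ z in ball 0 1, areaDensity α z * g z := by
  have hinv : ∀ z ∈ ball (0 : ℂ) 1, diskInvolution a (diskInvolution a z) = z := fun z hz =>
    diskInvolution_diskInvolution ha (mem_ball_zero_iff.1 hz)
  have himg : diskInvolution a '' ball 0 1 = ball 0 1 :=
    (mapsTo_diskInvolution ha).image_subset.antisymm fun z hz =>
      ⟨_, mapsTo_diskInvolution ha hz, hinv z hz⟩
  have hinj : InjOn (diskInvolution a) (ball 0 1) := fun x hx y hy hxy => by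
    rw [← hinv x hx, hxy, hinv y hy]
  have main := lintegral_image_eq_lintegral_abs_det_fderiv_mul volume
    (measurableSet_ball (x := (0 : ℂ)) (ε := 1))
    (fun z hz => ((hasDerivAt_diskInvolution ha
      (mem_ball_zero_iff.1 hz)).hasFDerivAt.restrictScalars ℝ).hasFDerivWithinAt) hinj
    -- After the substitution the argument of `g` is the involution applied twice, that is, `z`.
    (fun z => areaDensity α z * g (diskInvolution a z))
  rw [himg] at main
  rw [main, ← lintegral_const_mul' _ _ ENNReal.ofReal_ne_top]
  refine setLIntegral_mono' measurableSet_ball fun z hz => ?_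
  rw [det_restrictScalars_toSpanSingleton, norm_deriv_diskInvolution ha,
    abs_of_nonneg (by positivity), hinv z hz,
    ← mul_assoc, ← mul_assoc]
  exact mul_le_mul_left (ofReal_jacobian_mul_areaDensity_le hα ha (mem_ball_zero_iff.1 hz)) _

end Moebius

/-! ### The composition operator and its norm -/

section Composition

variable {H : Type*} [NormedAddCommGroup H] [InnerProductSpace ℂ H] [CompleteSpace H] {α : ℝ}

theorem setLIntegral_areaDensity_comp_le [hα : Fact (-1 < α)] {φ : ℂ → ℂ}
    (hφ : DifferentiableOn ℂ φ (ball 0 1)) (hmaps : MapsTo φ (ball 0 1) (ball 0 1)) {f : ℂ → H}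
    (hf : DifferentiableOn ℂ f (ball 0 1)) :
    ∫⁻ z in ball 0 1, areaDensity α z * ‖f (φ z)‖ₑ ^ 2 ≤
      ENNReal.ofReal (((1 + ‖φ 0‖) / (1 - ‖φ 0‖)) ^ (2 + α)) *
        ∫⁻ z in ball 0 1, areaDensity α z * ‖f z‖ₑ ^ 2 := by
  have ha : ‖φ 0‖ < 1 := mem_ball_zero_iff.1 (hmaps (mem_ball_self one_pos))
  have hinv := mapsTo_diskInvolution ha
  have hd := differentiableOn_diskInvolution ha
  have h0 : diskInvolution (φ 0) (φ 0) = 0 := by simp [diskInvolution]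
  -- Subordination is applied to f ∘ τ and to τ ∘ φ, where τ = `diskInvolution (φ 0)`; since τ ∘ τ =
  -- id on the disc, their composition is f ∘ φ.
  have h := (rotationInvariant_planeMeasure α).lintegral_comp_le (hd.comp hφ hmaps)
    (hinv.comp hmaps) h0 (hf.comp hd hinv)
  rw [setLIntegral_planeMeasure, setLIntegral_planeMeasure] at h
  refine le_trans (le_of_eq ?_)
    (h.trans (setLIntegral_comp_diskInvolution_le hα.out ha fun z => ‖f z‖ₑ ^ 2))
  refine setLIntegral_congr_fun measurableSet_ball fun z hz => ?_
  simp only [Function.comp_apply]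
  rw [diskInvolution_diskInvolution ha (mem_ball_zero_iff.1 (hmaps hz))]

variable {Φ : Disc → Disc}

theorem IsAnalytic.comp {X : Type*} [NormedAddCommGroup X] [NormedSpace ℂ X] [CompleteSpace X]
    {f : Disc → X} (hf : IsAnalytic f) (hΦ : IsAnalytic fun z => (Φ z : ℂ)) :
    IsAnalytic fun z => f (Φ z) := by
  obtain ⟨F, hF, hFf⟩ := hf.exists_differentiableOn
  obtain ⟨φ, hφ, hφΦ⟩ := hΦ.exists_differentiableOn
  have hmaps : MapsTo φ (ball 0 1) (ball 0 1) := fun z hz => by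
    rw [hφΦ ⟨z, hz⟩]
    exact (Φ ⟨z, hz⟩).2
  obtain ⟨y, hy⟩ := exists_hasSum_of_differentiableOn (hF.comp hφ hmaps)
  refine ⟨y, fun z => ?_⟩
  have h := hy z
  rwa [Function.comp_apply, hφΦ, hFf] at h

theorem IsAnalytic.lintegral_comp_le [Fact (-1 < α)] {f : Disc → H} (hf : IsAnalytic f)
    (hΦ : IsAnalytic fun z => (Φ z : ℂ)) :
    ∫⁻ z, ‖f (Φ z)‖ₑ ^ 2 ∂(areaMeasure α) ≤
      ENNReal.ofReal (((1 + ‖(Φ Disc.center : ℂ)‖) / (1 - ‖(Φ Disc.center : ℂ)‖)) ^ (2 + α)) *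
        ∫⁻ z, ‖f z‖ₑ ^ 2 ∂(areaMeasure α) := by
  obtain ⟨F, hF, hFf⟩ := hf.exists_differentiableOn
  obtain ⟨φ, hφ, hφΦ⟩ := hΦ.exists_differentiableOn
  have hmaps : MapsTo φ (ball 0 1) (ball 0 1) := fun z hz => by
    rw [hφΦ ⟨z, hz⟩]
    exact (Φ ⟨z, hz⟩).2
  have h := setLIntegral_areaDensity_comp_le (α := α) hφ hmaps hF
  rw [← lintegral_areaMeasure α fun z => ‖F (φ z)‖ₑ ^ 2,
    ← lintegral_areaMeasure α fun z => ‖F z‖ₑ ^ 2] at h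
  have h0 : φ 0 = Φ Disc.center := hφΦ Disc.center
  simpa only [hφΦ, hFf, h0] using h

namespace BergmanSpace

theorem ofReal_norm_sq [Fact (-1 < α)] (f : BergmanSpace α H) :
    ENNReal.ofReal (‖f‖ ^ 2) = ∫⁻ z, ‖f z‖ₑ ^ 2 ∂(areaMeasure α) := by
  rw [norm_sq_eq, ofReal_integral_eq_lintegral_ofReal
    ((memLp_two_iff_integrable_sq_norm f.memLp.1).1 f.memLp)
    (Eventually.of_forall fun z => by positivity)]
  congr 1 with z
  rw [ENNReal.ofReal_pow (norm_nonneg _), ofReal_norm]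

/-- The composition operator `f ↦ f ∘ Φ` as a linear map. -/
def compLinearMap (α : ℝ) [Fact (-1 < α)] (H : Type*) [NormedAddCommGroup H]
    [InnerProductSpace ℂ H] [CompleteSpace H] (hΦ : IsAnalytic fun z => (Φ z : ℂ)) :
    BergmanSpace α H →ₗ[ℂ] BergmanSpace α H where
  toFun f := ⟨fun z => f (Φ z), f.2.1.comp hΦ, (f.2.1.lintegral_comp_le hΦ).trans_lt
    (ENNReal.mul_lt_top ENNReal.ofReal_lt_top f.2.2)⟩
  map_add' _ _ := rfl
  map_smul' _ _ := rfl

theorem norm_compLinearMap_le [hα : Fact (-1 < α)] (hΦ : IsAnalytic fun z => (Φ z : ℂ))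
    (f : BergmanSpace α H) :
    ‖compLinearMap α H hΦ f‖ ≤
      ((1 + ‖(Φ Disc.center : ℂ)‖) / (1 - ‖(Φ Disc.center : ℂ)‖)) ^ ((2 + α) / 2) * ‖f‖ := by
  have h : ENNReal.ofReal (‖compLinearMap α H hΦ f‖ ^ 2) ≤ _ * ∫⁻ z, ‖f z‖ₑ ^ 2 ∂(areaMeasure α) :=
    (ofReal_norm_sq _).trans_le (f.2.1.lintegral_comp_le hΦ)
  have ha : ‖(Φ Disc.center : ℂ)‖ < 1 := mem_ball_zero_iff.1 (Φ Disc.center).2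
  set K := (1 + ‖(Φ Disc.center : ℂ)‖) / (1 - ‖(Φ Disc.center : ℂ)‖)
  have hK : 0 ≤ K := div_nonneg (by positivity) (sub_nonneg.2 ha.le)
  rw [← ofReal_norm_sq, ← ENNReal.ofReal_mul (by positivity),
    ENNReal.ofReal_le_ofReal_iff (by positivity)] at h
  -- The integral estimate concerns squared norms, hence the halved exponent.
  refine (pow_le_pow_iff_left₀ (norm_nonneg _) (by positivity) two_ne_zero).1 ?_
  rw [mul_pow, ← Real.rpow_mul_natCast hK]
  simpa using h

/-- The constant functions in the Bergman space. -/
def const (α : ℝ) [Fact (-1 < α)] (c : H) : BergmanSpace α H :=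
  ⟨fun _ => c, ⟨fun n => if n = 0 then c else 0, fun z => by
    convert hasSum_ite_eq 0 c using 2 with n
    split_ifs with hn <;> simp [hn]⟩, by
    rw [lintegral_const]
    exact ENNReal.mul_lt_top (by simp) (measure_lt_top _ _)⟩

theorem const_ne_zero [Fact (-1 < α)] {c : H} (hc : c ≠ 0) : const α c ≠ 0 := fun h =>
  hc (congrFun (congrArg Subtype.val h) Disc.center)

end BergmanSpace

end Composition

end VectorBergman

end

theorem mainTheorem7 {H : Type*} [NormedAddCommGroup H] [InnerProductSpace ℂ H] [CompleteSpace H]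
    [TopologicalSpace.SeparableSpace H] (α : ℝ) [Fact (-1 < α)]
    (Φ : VectorBergman.Disc → VectorBergman.Disc)
    (hΦ : VectorBergman.IsAnalytic fun z => (Φ z : ℂ)) :
    ∃ C : VectorBergman.BergmanSpace α H →L[ℂ] VectorBergman.BergmanSpace α H,
      (∀ f z, C f z = f (Φ z)) ∧
      ‖C‖ ≤ ((1 + ‖(Φ VectorBergman.Disc.center : ℂ)‖) /
        (1 - ‖(Φ VectorBergman.Disc.center : ℂ)‖)) ^ ((2 + α) / 2) ∧
      (Nontrivial H → (Φ VectorBergman.Disc.center : ℂ) = 0 → ‖C‖ = 1) := by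
  have hC := VectorBergman.BergmanSpace.norm_compLinearMap_le (H := H) (α := α) hΦ
  have ha : ‖(Φ VectorBergman.Disc.center : ℂ)‖ < 1 :=
    mem_ball_zero_iff.1 (Φ VectorBergman.Disc.center).2
  have hbound : ‖(VectorBergman.BergmanSpace.compLinearMap α H hΦ).mkContinuous _ hC‖ ≤
      ((1 + ‖(Φ VectorBergman.Disc.center : ℂ)‖) /
        (1 - ‖(Φ VectorBergman.Disc.center : ℂ)‖)) ^ ((2 + α) / 2) :=
    LinearMap.mkContinuous_norm_le _
      (Real.rpow_nonneg (div_nonneg (by positivity) (sub_nonneg.2 ha.le)) _) hC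
  refine ⟨_, fun f z => rfl, hbound, fun hH h0 => le_antisymm ?_ ?_⟩
  · simpa [h0] using hbound
  · obtain ⟨c, hc⟩ := exists_ne (0 : H)
    have h := ((VectorBergman.BergmanSpace.compLinearMap α H hΦ).mkContinuous _ hC).le_opNorm
      (VectorBergman.BergmanSpace.const α c)
    -- The operator fixes constants definitionally, so `h` reads ‖const‖ ≤ ‖C‖ * ‖const‖.
    exact le_of_mul_le_mul_right ((one_mul _).trans_le h)
      (norm_pos_iff.2 (VectorBergman.BergmanSpace.const_ne_zero hc))
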